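/- Let $K$ be a field, $S=K[x_1,\dots,x_n]$ with its standard grading, and let $I\subseteq S$ be a nonzero monomial ideal. Let $G(I)$ be the minimal set of monomial generators of $I$, let $\deg(I)$ be the highest degree of a monomial of $G(I)$, and put $m(u)=\max\{i : x_i\mid u\}$ for a monomial $u$ (with $m(1)=0$) and $m(I)=\max_{u\in G(I)}m(u)$. Let $\operatorname{reg}(I)=\max\{j-i : \beta_{ij}(I)\neq 0\}$ be the Castelnuovo--Mumford regularity of $I$, where the graded Betti number $\beta_{ij}(I)$ is the number of basis elements of degree $j$ in the $i$-th module of a minimal graded free resolution of $I$ over $S$. If $I$ is of Borel type, that is, if $(I:x_j^\infty)=(I:(x_1,\dots,x_j)^\infty)$ for all $j=1,\dots,n$, then $$\operatorname{reg}(I)\le m(I)\,(\deg(I)-1)+1 .$$ -/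

import Mathlib

open MvPolynomial

namespace BorelReg

variable {K : Type*} [Field K] {n : ℕ}

/-- `I` is a monomial ideal: it is generated by monomials. -/
def IsMonomialIdeal (I : Ideal (MvPolynomial (Fin n) K)) : Prop :=
  ∃ A : Set (Fin n →₀ ℕ), I = Ideal.span ((fun a => monomial a (1 : K)) '' A)

/-- The exponents of the monomials in `G(I)`, the minimal set of monomial generators of `I`:
the monomials of `I` that are minimal for divisibility (the pointwise order on exponents). -/
def minGens (I : Ideal (MvPolynomial (Fin n) K)) : Set (Fin n →₀ ℕ) :=
  {a | Minimal (fun b => monomial b (1 : K) ∈ I) a}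

/-- `deg(I)`, the highest degree of a monomial of `G(I)`. (`G(I)` is always finite.) -/
noncomputable def degI (I : Ideal (MvPolynomial (Fin n) K)) : ℕ :=
  sSup ((fun a : Fin n →₀ ℕ => a.degree) '' minGens I)

/-- `m(u) = max {i | x_i ∣ u}` for `u = x ^ a`, with `x_1, …, x_n` numbered from `1`, so that
`X i` is `x_{i+1}`; `m(1) = 0`. -/
def mMon (a : Fin n →₀ ℕ) : ℕ := a.support.sup fun i => (i : ℕ) + 1

/-- `m(I) = max_{u ∈ G(I)} m(u)`. -/
noncomputable def mI (I : Ideal (MvPolynomial (Fin n) K)) : ℕ :=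
  sSup (mMon '' minGens I)

/-- `(I : J^∞) = ⋃_k (I : J^k)`; the union is increasing, so it is the supremum. -/
noncomputable def saturation (I J : Ideal (MvPolynomial (Fin n) K)) : Ideal (MvPolynomial (Fin n) K) :=
  ⨆ k : ℕ, I.colon ((J ^ k : Ideal (MvPolynomial (Fin n) K)) : Set (MvPolynomial (Fin n) K))

/-- A monomial ideal `I` is of Borel type if `(I : x_j^∞) = (I : (x_1, …, x_j)^∞)` for all `j`. -/
def IsBorelType (I : Ideal (MvPolynomial (Fin n) K)) : Prop :=
  IsMonomialIdeal I ∧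
    ∀ j : Fin n, saturation I (Ideal.span {X j}) = saturation I (Ideal.span (X '' Set.Iic j))

/-- A vector of the graded free module `⨁_b S(-w b)` is homogeneous of degree `d`. -/
def IsHomogeneousVec {r : ℕ} (w : Fin r → ℤ) (v : Fin r → MvPolynomial (Fin n) K) (d : ℤ) : Prop :=
  ∀ b, ∀ e ∈ (v b).support, (e.degree : ℤ) + w b = d

/-- A minimal graded free resolution `⋯ → F_1 → F_0 → I → 0` of the ideal `I` over
`S = K[x_1, …, x_n]`, where `F_i = ⨁_a S(-w_i(a))` is free of finite rank, with its basis
vector number `a` in degree `w_i(a)`, and all maps are homogeneous of degree `0`. -/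
structure MinGradedFreeRes (I : Ideal (MvPolynomial (Fin n) K)) where
  rank : ℕ → ℕ
  w : ∀ i, Fin (rank i) → ℤ
  d : ∀ i, (Fin (rank (i + 1)) → MvPolynomial (Fin n) K) →ₗ[MvPolynomial (Fin n) K]
    (Fin (rank i) → MvPolynomial (Fin n) K)
  aug : (Fin (rank 0) → MvPolynomial (Fin n) K) →ₗ[MvPolynomial (Fin n) K] I
  d_homogeneous : ∀ i a, IsHomogeneousVec (w i) (d i (Pi.single a 1)) (w (i + 1) a)
  aug_homogeneous : ∀ a, ∀ e ∈ (aug (Pi.single a 1) : MvPolynomial (Fin n) K).support,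
    (e.degree : ℤ) = w 0 a
  aug_surjective : Function.Surjective aug
  exact_zero : Function.Exact (d 0) aug
  exact_succ : ∀ i, Function.Exact (d (i + 1)) (d i)
  /-- Minimality: the image of `F_{i+1}` lies in `(x_1, …, x_n) F_i`. -/
  minimal : ∀ i v b, d i v b ∈ Ideal.span (Set.range (X : Fin n → MvPolynomial (Fin n) K))

/-- The graded Betti number `β_{ij}(I)`: the number of basis vectors of degree `j` in the `i`-th
module of a minimal graded free resolution. -/
def MinGradedFreeRes.betti {I : Ideal (MvPolynomial (Fin n) K)} (F : MinGradedFreeRes I)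
    (i : ℕ) (j : ℤ) : ℕ :=
  Fintype.card {a : Fin (F.rank i) // F.w i a = j}

/-- `r = reg(I) = max {j - i | β_{ij}(I) ≠ 0}`, as read off from the resolution `F`. -/
def MinGradedFreeRes.IsReg {I : Ideal (MvPolynomial (Fin n) K)} (F : MinGradedFreeRes I)
    (r : ℤ) : Prop :=
  IsGreatest {t : ℤ | ∃ (i : ℕ) (j : ℤ), F.betti i j ≠ 0 ∧ t = j - i} r

end BorelReg

/-! Write m = m(I), d = deg(I) and ρ = m(d - 1) + 1, with variables numbered from 0. Two facts carry
the proof.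

Combinatorial (`IsBorelType.monomial_mem_of_add_single`, `IsBorelType.mem_sup_varsGe_of_X_mul_mem`):
`X k` acts injectively in degrees ≥ ρ on S/I modulo the variables after `X k`. If k < m, a monomial
of such degree in `X 0, …, X k` is divisible by some `X i ^ d`, and the Borel condition trades the
power of `X k` in a generator for a power of `X i`, of which a minimal generator uses at most d.

Homological (`GradedRes.exists_boundary_of_cycle`): let P be the resolution of S/I obtained from F.
Killing the variables one at a time from the last to the first keeps P exact at place i + 1 in
degrees > ρ + i; each step is the long exact sequence of multiplication by `X k`, done by hand. Once
all variables are killed, minimality makes the differentials vanish in these degrees, so F_i, which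
is place i + 1 of P, has no basis vector of degree > ρ + i (`MinGradedFreeRes.w_le`). -/

namespace BorelReg

variable {K : Type*} [Field K] {n : ℕ}

/-! ### Graded components in S and in graded free modules -/

/-- The component of degree `t ∈ ℤ` of a polynomial. -/
noncomputable def comp (t : ℤ) (f : MvPolynomial (Fin n) K) : MvPolynomial (Fin n) K :=
  if 0 ≤ t then homogeneousComponent t.toNat f else 0

theorem coeff_comp (t : ℤ) (f : MvPolynomial (Fin n) K) (e : Fin n →₀ ℕ) :
    coeff e (comp t f) = if (e.degree : ℤ) = t then coeff e f else 0 := by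
  unfold comp
  by_cases ht : 0 ≤ t
  · obtain ⟨m, rfl⟩ := Int.eq_ofNat_of_zero_le ht
    simp [coeff_homogeneousComponent]
  · have : ¬ (e.degree : ℤ) = t := by omega
    simp [ht, this]

theorem comp_sub (t : ℤ) (f g : MvPolynomial (Fin n) K) : comp t (f - g) = comp t f - comp t g := by
  ext e
  simp only [coeff_comp, coeff_sub]
  split_ifs <;> simp

theorem comp_zero (t : ℤ) : comp t (0 : MvPolynomial (Fin n) K) = 0 := by
  ext e; simp [coeff_comp]

theorem comp_sum {ι : Type*} (s : Finset ι) (t : ℤ) (f : ι → MvPolynomial (Fin n) K) :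
    comp t (∑ i ∈ s, f i) = ∑ i ∈ s, comp t (f i) := by
  ext e
  simp only [coeff_comp, coeff_sum]
  split_ifs <;> simp

/-- All monomials of `f` have degree `t`. -/
def IsHomog (t : ℤ) (f : MvPolynomial (Fin n) K) : Prop :=
  ∀ e ∈ f.support, (e.degree : ℤ) = t

theorem isHomog_comp (t : ℤ) (f : MvPolynomial (Fin n) K) : IsHomog t (comp t f) := by
  intro e he
  rw [mem_support_iff, coeff_comp] at he
  by_contra h
  simp [h] at he

theorem IsHomog.comp_eq {t : ℤ} {f : MvPolynomial (Fin n) K} (h : IsHomog t f) : comp t f = f := by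
  ext e
  rw [coeff_comp]
  split_ifs with h1
  · rfl
  · by_contra h2
    exact h1 (h e (mem_support_iff.2 (Ne.symm h2)))

theorem isHomog_iff_comp_eq {t : ℤ} {f : MvPolynomial (Fin n) K} : IsHomog t f ↔ comp t f = f :=
  ⟨IsHomog.comp_eq, fun h => h ▸ isHomog_comp t f⟩

theorem comp_mul_of_isHomog {s : ℤ} (t : ℤ) (f : MvPolynomial (Fin n) K)
    {g : MvPolynomial (Fin n) K} (hg : IsHomog s g) : comp t (f * g) = comp (t - s) f * g := by
  ext e
  rw [coeff_comp, coeff_mul, coeff_mul]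
  have key : ∀ p ∈ Finset.HasAntidiagonal.antidiagonal e, coeff p.1 (comp (t - s) f) * coeff p.2 g =
      if (e.degree : ℤ) = t then coeff p.1 f * coeff p.2 g else 0 := by
    intro p hp
    by_cases h0 : coeff p.2 g = 0
    · simp [h0]
    · have h1 := hg _ (mem_support_iff.2 h0)
      have h2 : (p.1.degree : ℤ) + p.2.degree = e.degree := by
        rw [← Finset.HasAntidiagonal.mem_antidiagonal.1 hp, map_add, Nat.cast_add]
      have h3 : (p.1.degree : ℤ) = t - s ↔ (e.degree : ℤ) = t := by omega
      rw [coeff_comp]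
      simp only [h3]
      split_ifs <;> simp
  rw [Finset.sum_congr rfl key]
  split_ifs <;> simp

theorem isHomog_X (k : Fin n) : IsHomog 1 (X k : MvPolynomial (Fin n) K) := by
  intro e he
  rw [support_X, Finset.mem_singleton] at he
  simp [he, Finsupp.degree_single]

theorem IsHomog.mul {s t : ℤ} {f g : MvPolynomial (Fin n) K} (hf : IsHomog s f)
    (hg : IsHomog t g) : IsHomog (s + t) (f * g) := by
  rw [isHomog_iff_comp_eq, comp_mul_of_isHomog _ _ hg, add_sub_cancel_right, hf.comp_eq]

theorem IsHomog.sub {t : ℤ} {f g : MvPolynomial (Fin n) K} (hf : IsHomog t f)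
    (hg : IsHomog t g) : IsHomog t (f - g) := by
  rw [isHomog_iff_comp_eq, comp_sub, hf.comp_eq, hg.comp_eq]

/-- The component of degree `t` of a vector of the graded free module `⨁_b S(-w b)`. -/
noncomputable def compVec {r : ℕ} (w : Fin r → ℤ) (t : ℤ) (v : Fin r → MvPolynomial (Fin n) K) :
    Fin r → MvPolynomial (Fin n) K :=
  fun b => comp (t - w b) (v b)

theorem isHomogeneousVec_iff {r : ℕ} {w : Fin r → ℤ} {v : Fin r → MvPolynomial (Fin n) K} {t : ℤ} :
    IsHomogeneousVec w v t ↔ ∀ b, IsHomog (t - w b) (v b) :=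
  forall_congr' fun _ => forall₂_congr fun _ _ => eq_sub_iff_add_eq.symm

theorem isHomogeneousVec_compVec {r : ℕ} (w : Fin r → ℤ) (t : ℤ)
    (v : Fin r → MvPolynomial (Fin n) K) : IsHomogeneousVec w (compVec w t v) t :=
  isHomogeneousVec_iff.2 fun _ => isHomog_comp _ _

theorem IsHomogeneousVec.compVec_eq {r : ℕ} {w : Fin r → ℤ} {v : Fin r → MvPolynomial (Fin n) K}
    {t : ℤ} (h : IsHomogeneousVec w v t) : compVec w t v = v :=
  funext fun b => (isHomogeneousVec_iff.1 h b).comp_eq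

theorem isHomogeneousVec_single {r : ℕ} (w : Fin r → ℤ) (a : Fin r) :
    IsHomogeneousVec w (Pi.single a (1 : MvPolynomial (Fin n) K)) (w a) := by
  intro b e he
  by_cases hb : b = a
  · subst hb
    rw [Pi.single_eq_same, mem_support_iff, coeff_one] at he
    have : e = 0 := by
      by_contra h
      simp [Ne.symm h] at he
    simp [this]
  · simp [Pi.single_eq_of_ne hb] at he

theorem exists_sum_compVec {r : ℕ} (w : Fin r → ℤ) (v : Fin r → MvPolynomial (Fin n) K) :
    ∃ A : Finset ℤ, ∑ t ∈ A, compVec w t v = v := by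
  refine ⟨Finset.univ.biUnion fun b => (v b).support.image fun e => (e.degree : ℤ) + w b, ?_⟩
  ext b e
  simp only [Finset.sum_apply, coeff_sum, compVec, coeff_comp, eq_sub_iff_add_eq,
    Finset.sum_ite_eq]
  split_ifs with h
  · rfl
  · by_contra h1
    exact h (Finset.mem_biUnion.2 ⟨b, Finset.mem_univ _,
      Finset.mem_image.2 ⟨e, mem_support_iff.2 (Ne.symm h1), rfl⟩⟩)

theorem linearMap_apply_eq_sum {r : ℕ} {M : Type*} [AddCommGroup M] [Module (MvPolynomial (Fin n) K) M]
    (φ : (Fin r → MvPolynomial (Fin n) K) →ₗ[MvPolynomial (Fin n) K] M)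
    (v : Fin r → MvPolynomial (Fin n) K) : φ v = ∑ a, v a • φ (Pi.single a 1) := by
  conv_lhs => rw [pi_eq_sum_univ' v]
  simp

/-- This makes kernels graded and lets a preimage of a homogeneous vector be replaced by a
homogeneous one. -/
theorem map_compVec {r s : ℕ} {w : Fin r → ℤ} {w' : Fin s → ℤ}
    (φ : (Fin r → MvPolynomial (Fin n) K) →ₗ[MvPolynomial (Fin n) K]
      (Fin s → MvPolynomial (Fin n) K))
    (hφ : ∀ a, IsHomogeneousVec w' (φ (Pi.single a 1)) (w a)) (t : ℤ)
    (v : Fin r → MvPolynomial (Fin n) K) :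
    φ (compVec w t v) = compVec w' t (φ v) := by
  funext b
  rw [linearMap_apply_eq_sum φ (compVec w t v), compVec, linearMap_apply_eq_sum φ v]
  simp only [Finset.sum_apply, Pi.smul_apply, smul_eq_mul, comp_sum]
  refine Finset.sum_congr rfl fun a _ => ?_
  rw [comp_mul_of_isHomog _ _ (isHomogeneousVec_iff.1 (hφ a) b), compVec]
  congr 2
  ring

theorem IsHomogeneousVec.map {r s : ℕ} {w : Fin r → ℤ} {w' : Fin s → ℤ}
    {φ : (Fin r → MvPolynomial (Fin n) K) →ₗ[MvPolynomial (Fin n) K]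
      (Fin s → MvPolynomial (Fin n) K)}
    (hφ : ∀ a, IsHomogeneousVec w' (φ (Pi.single a 1)) (w a)) {t : ℤ}
    {v : Fin r → MvPolynomial (Fin n) K} (hv : IsHomogeneousVec w v t) :
    IsHomogeneousVec w' (φ v) t := by
  rw [← hv.compVec_eq, map_compVec φ hφ]
  exact isHomogeneousVec_compVec _ _ _

/-! ### Graded submodules and their minimal covers -/

/-- A submodule of `⨁_b S(-w b)` is graded if it contains the components of its elements. -/
def IsGradedSubmodule {r : ℕ} (w : Fin r → ℤ)
    (Z : Submodule (MvPolynomial (Fin n) K) (Fin r → MvPolynomial (Fin n) K)) : Prop :=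
  ∀ t, ∀ v ∈ Z, compVec w t v ∈ Z

theorem isGradedSubmodule_ker {r s : ℕ} {w : Fin r → ℤ} {w' : Fin s → ℤ}
    (φ : (Fin r → MvPolynomial (Fin n) K) →ₗ[MvPolynomial (Fin n) K]
      (Fin s → MvPolynomial (Fin n) K))
    (hφ : ∀ a, IsHomogeneousVec w' (φ (Pi.single a 1)) (w a)) :
    IsGradedSubmodule w (LinearMap.ker φ) := by
  intro t v hv
  rw [LinearMap.mem_ker] at hv ⊢
  rw [map_compVec φ hφ, hv]
  exact funext fun b => comp_zero _

theorem IsGradedSubmodule.exists_generators {r : ℕ} {w : Fin r → ℤ}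
    {Z : Submodule (MvPolynomial (Fin n) K) (Fin r → MvPolynomial (Fin n) K)}
    (hZ : IsGradedSubmodule w Z) :
    ∃ (m : ℕ) (z : Fin m → Fin r → MvPolynomial (Fin n) K) (u : Fin m → ℤ),
      (∀ a, IsHomogeneousVec w (z a) (u a)) ∧
        Submodule.span (MvPolynomial (Fin n) K) (Set.range z) = Z := by
  set G : Set (Fin r → MvPolynomial (Fin n) K) := {v | v ∈ Z ∧ ∃ t, IsHomogeneousVec w v t}
  have hG : Submodule.span (MvPolynomial (Fin n) K) G = Z := by
    refine le_antisymm (Submodule.span_le.2 fun v hv => hv.1) fun v hv => ?_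
    obtain ⟨A, hA⟩ := exists_sum_compVec w v
    rw [← hA]
    exact Submodule.sum_mem _ fun t _ =>
      Submodule.subset_span ⟨hZ t v hv, t, isHomogeneousVec_compVec w t v⟩
  have hfg : (Submodule.span (MvPolynomial (Fin n) K) G).FG := IsNoetherian.noetherian _
  obtain ⟨s, hsG, hs⟩ := (Submodule.fg_span_iff_fg_span_finset_subset G).1 hfg
  have hdeg : ∀ a, ∃ t, IsHomogeneousVec w (s.equivFin.symm a : Fin r → MvPolynomial (Fin n) K) t :=
    fun a => (hsG (s.equivFin.symm a).2).2
  choose u hu using hdeg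
  refine ⟨s.card, fun a => s.equivFin.symm a, u, hu, ?_⟩
  rw [← hG, hs]
  congr 1
  ext v
  constructor
  · rintro ⟨a, rfl⟩
    exact (s.equivFin.symm a).2
  · intro hv
    exact ⟨s.equivFin ⟨v, hv⟩, by simp⟩

theorem mem_span_range_X_iff {f : MvPolynomial (Fin n) K} :
    f ∈ Ideal.span (Set.range (X : Fin n → MvPolynomial (Fin n) K)) ↔ coeff 0 f = 0 := by
  rw [← Set.image_univ, mem_ideal_span_X_image]
  constructor
  · intro h
    by_contra h0
    obtain ⟨i, -, hi⟩ := h 0 (mem_support_iff.2 h0)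
    exact hi rfl
  · intro h e he
    by_contra! h1
    have : e = 0 := Finsupp.ext fun i => h1 i (Set.mem_univ i)
    exact mem_support_iff.1 he (this ▸ h)

theorem comp_zero_eq_C (f : MvPolynomial (Fin n) K) : comp 0 f = C (coeff 0 f) := by
  ext e
  rw [coeff_comp, coeff_C]
  by_cases h : e = 0
  · simp [h]
  · have h' : (0 : Fin n →₀ ℕ) ≠ e := fun h1 => h h1.symm
    simp [h', Finsupp.degree_eq_zero_iff, h]

/-- The minimal homogeneous cover of a graded submodule of a graded free module. -/
theorem IsGradedSubmodule.exists_minimal_cover {r : ℕ} {w : Fin r → ℤ}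
    {Z : Submodule (MvPolynomial (Fin n) K) (Fin r → MvPolynomial (Fin n) K)}
    (hZ : IsGradedSubmodule w Z) :
    ∃ (m : ℕ) (u : Fin m → ℤ) (φ : (Fin m → MvPolynomial (Fin n) K) →ₗ[MvPolynomial (Fin n) K]
      (Fin r → MvPolynomial (Fin n) K)),
      (∀ a, IsHomogeneousVec w (φ (Pi.single a 1)) (u a)) ∧ LinearMap.range φ = Z ∧
        ∀ v ∈ LinearMap.ker φ, ∀ b,
          v b ∈ Ideal.span (Set.range (X : Fin n → MvPolynomial (Fin n) K)) := by
  classical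
  have hex := hZ.exists_generators
  -- Minimality comes from taking the least possible number of homogeneous generators.
  obtain ⟨z, u, hz, hspan⟩ := Nat.find_spec hex
  have hmin := fun m => Nat.find_min hex (m := m)
  generalize Nat.find hex = m at z u hz hspan hmin
  have hφ : ∀ a, IsHomogeneousVec w (Fintype.linearCombination (MvPolynomial (Fin n) K) z
      (Pi.single a 1)) (u a) := fun a => by
    rw [Fintype.linearCombination_apply_single, one_smul]
    exact hz a
  refine ⟨m, u, Fintype.linearCombination (MvPolynomial (Fin n) K) z, hφ,
    by rw [Fintype.range_linearCombination, hspan], fun v hv a => ?_⟩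
  rw [mem_span_range_X_iff]
  by_contra hne
  -- In the degree `u a` part of the relation, the coefficient of `z a` is the constant term of `v
  -- a`. If it is nonzero, `z a` is redundant.
  have hv0 := isGradedSubmodule_ker _ hφ (u a) v hv
  rw [LinearMap.mem_ker, Fintype.linearCombination_apply] at hv0
  obtain _ | m := m
  · exact a.elim0
  rw [Fin.sum_univ_succAbove _ a] at hv0
  simp only [compVec, sub_self, comp_zero_eq_C] at hv0
  refine hmin m (Nat.lt_succ_self m) ⟨fun b => z (a.succAbove b), fun b => u (a.succAbove b),
    fun b => hz _, le_antisymm ?_ ?_⟩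
  · rw [← hspan]
    refine Submodule.span_mono ?_
    rintro _ ⟨b, rfl⟩
    exact ⟨_, rfl⟩
  · rw [← hspan, Submodule.span_le]
    have hothers : ∀ b, z (a.succAbove b) ∈ Submodule.span (MvPolynomial (Fin n) K)
        (Set.range fun b => z (a.succAbove b)) := fun b => Submodule.subset_span ⟨b, rfl⟩
    rintro _ ⟨b, rfl⟩
    rcases Fin.eq_self_or_eq_succAbove a b with rfl | ⟨c, rfl⟩
    · have h1 : (C (coeff 0 (v b)) : MvPolynomial (Fin n) K) • z b ∈
          Submodule.span (MvPolynomial (Fin n) K) (Set.range fun c => z (b.succAbove c)) := by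
        rw [eq_neg_of_add_eq_zero_left hv0]
        exact Submodule.neg_mem _ (Submodule.sum_mem _ fun c _ => Submodule.smul_mem _ _ (hothers c))
      have h2 := Submodule.smul_mem _ (C (coeff 0 (v b))⁻¹ : MvPolynomial (Fin n) K) h1
      rwa [smul_smul, ← C_mul, inv_mul_cancel₀ hne, C_1, one_smul] at h2
    · exact hothers c

/-! ### Minimal resolutions of monomial ideals by iterated syzygies -/

theorem IsMonomialIdeal.mem_iff {I : Ideal (MvPolynomial (Fin n) K)} (hI : IsMonomialIdeal I)
    {f : MvPolynomial (Fin n) K} : f ∈ I ↔ ∀ e ∈ f.support, monomial e (1 : K) ∈ I := by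
  classical
  obtain ⟨A, rfl⟩ := hI
  simp only [mem_ideal_span_monomial_image, support_monomial, one_ne_zero, if_false,
    Finset.mem_singleton, forall_eq]

theorem monomial_mem_of_le {I : Ideal (MvPolynomial (Fin n) K)} {a b : Fin n →₀ ℕ} (h : a ≤ b)
    (ha : monomial a (1 : K) ∈ I) : monomial b (1 : K) ∈ I := by
  rw [← tsub_add_cancel_of_le h, ← one_mul (1 : K), ← monomial_mul]
  exact I.mul_mem_left _ ha

/-- The identification of `S` with the free module `S^1`. -/
noncomputable def vecOne :
    MvPolynomial (Fin n) K ≃ₗ[MvPolynomial (Fin n) K] (Fin 1 → MvPolynomial (Fin n) K) :=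
  (LinearEquiv.funUnique (Fin 1) (MvPolynomial (Fin n) K) (MvPolynomial (Fin n) K)).symm

theorem vecOne_apply (f : MvPolynomial (Fin n) K) (b : Fin 1) : vecOne f b = f := rfl

theorem IsMonomialIdeal.isGradedSubmodule_map_vecOne {I : Ideal (MvPolynomial (Fin n) K)}
    (hI : IsMonomialIdeal I) :
    IsGradedSubmodule (fun _ : Fin 1 => 0) (Submodule.map vecOne.toLinearMap I) := by
  rintro t _ ⟨f, hf, rfl⟩
  refine ⟨comp t f, hI.mem_iff.2 fun e he => hI.mem_iff.1 hf e ?_, ?_⟩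
  · rw [mem_support_iff, coeff_comp] at he
    exact mem_support_iff.2 fun h => he (by simp [h])
  · funext b
    simp [compVec, vecOne_apply]

/-- A graded submodule of a graded free module of finite rank. -/
structure GradedSub (K : Type*) [Field K] (n : ℕ) where
  rank : ℕ
  w : Fin rank → ℤ
  carrier : Submodule (MvPolynomial (Fin n) K) (Fin rank → MvPolynomial (Fin n) K)
  isGraded : IsGradedSubmodule w carrier

namespace GradedSub

/-- The number of generators of a chosen minimal cover. -/
noncomputable def coverRank (Z : GradedSub K n) : ℕ := Z.isGraded.exists_minimal_cover.choose

/-- The degrees of the generators of a chosen minimal cover. -/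
noncomputable def coverWeight (Z : GradedSub K n) : Fin Z.coverRank → ℤ :=
  Z.isGraded.exists_minimal_cover.choose_spec.choose

/-- A chosen minimal cover. -/
noncomputable def cover (Z : GradedSub K n) :
    (Fin Z.coverRank → MvPolynomial (Fin n) K) →ₗ[MvPolynomial (Fin n) K]
      (Fin Z.rank → MvPolynomial (Fin n) K) :=
  Z.isGraded.exists_minimal_cover.choose_spec.choose_spec.choose

theorem cover_homogeneous (Z : GradedSub K n) (a : Fin Z.coverRank) :
    IsHomogeneousVec Z.w (Z.cover (Pi.single a 1)) (Z.coverWeight a) :=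
  Z.isGraded.exists_minimal_cover.choose_spec.choose_spec.choose_spec.1 a

theorem range_cover (Z : GradedSub K n) : LinearMap.range Z.cover = Z.carrier :=
  Z.isGraded.exists_minimal_cover.choose_spec.choose_spec.choose_spec.2.1

theorem cover_minimal (Z : GradedSub K n) (v : Fin Z.coverRank → MvPolynomial (Fin n) K)
    (hv : v ∈ LinearMap.ker Z.cover) (b : Fin Z.coverRank) :
    v b ∈ Ideal.span (Set.range (X : Fin n → MvPolynomial (Fin n) K)) :=
  Z.isGraded.exists_minimal_cover.choose_spec.choose_spec.choose_spec.2.2 v hv b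

/-- The syzygies of the chosen minimal cover. -/
noncomputable def syzygy (Z : GradedSub K n) : GradedSub K n where
  rank := Z.coverRank
  w := Z.coverWeight
  carrier := LinearMap.ker Z.cover
  isGraded := isGradedSubmodule_ker Z.cover Z.cover_homogeneous

theorem cover_exact (Z : GradedSub K n) : Function.Exact Z.syzygy.cover Z.cover :=
  LinearMap.exact_iff.2 Z.syzygy.range_cover.symm

/-- The iterated syzygies. -/
noncomputable def iterSyzygy (Z : GradedSub K n) : ℕ → GradedSub K n
  | 0 => Z
  | i + 1 => (Z.iterSyzygy i).syzygy

end GradedSub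

/-- Every monomial ideal has a minimal graded free resolution. -/
theorem IsMonomialIdeal.nonempty_minGradedFreeRes {I : Ideal (MvPolynomial (Fin n) K)}
    (hI : IsMonomialIdeal I) : Nonempty (MinGradedFreeRes I) := by
  set Z : GradedSub K n := ⟨1, fun _ => 0, _, hI.isGradedSubmodule_map_vecOne⟩
  have haug : ∀ v, vecOne.symm (Z.cover v) ∈ I := fun v => by
    have h : Z.cover v ∈ Z.carrier := Z.range_cover ▸ LinearMap.mem_range_self _ v
    obtain ⟨f, hf, h⟩ := h
    have h' : vecOne f = Z.cover v := h
    rw [← h', LinearEquiv.symm_apply_apply]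
    exact hf
  refine ⟨{
    rank := fun i => (Z.iterSyzygy i).coverRank
    w := fun i => (Z.iterSyzygy i).coverWeight
    d := fun i => (Z.iterSyzygy (i + 1)).cover
    aug := (vecOne.symm.toLinearMap ∘ₗ Z.cover).codRestrict I haug
    d_homogeneous := fun i a => (Z.iterSyzygy (i + 1)).cover_homogeneous a
    aug_homogeneous := fun a e he => ?_
    aug_surjective := ?_
    exact_zero := ?_
    exact_succ := fun i => (Z.iterSyzygy (i + 1)).cover_exact
    minimal := fun i v b => (Z.iterSyzygy i).cover_minimal _ ?_ b }⟩
  · have h : (e.degree : ℤ) + 0 = Z.coverWeight a := Z.cover_homogeneous a 0 e he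
    rw [add_zero] at h
    exact h
  · rintro ⟨f, hf⟩
    have h : vecOne f ∈ LinearMap.range Z.cover := by
      rw [Z.range_cover]
      exact ⟨f, hf, rfl⟩
    obtain ⟨v, hv⟩ := h
    refine ⟨v, Subtype.ext ?_⟩
    change vecOne.symm (Z.cover v) = f
    rw [hv, LinearEquiv.symm_apply_apply]
  · intro v
    refine Iff.trans ?_ (Z.cover_exact v)
    exact Subtype.ext_iff.trans (LinearEquiv.map_eq_zero_iff (vecOne (K := K) (n := n)).symm)
  · exact ((Z.iterSyzygy i).cover_exact _).2 ⟨v, rfl⟩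

/-! ### Minimal generators and exchange of variables in ideals of Borel type -/

theorem minGens_finite (I : Ideal (MvPolynomial (Fin n) K)) : (minGens I).Finite :=
  WellQuasiOrderedLE.finite_of_isAntichain (setOfPred_minimal_antichain _)

theorem exists_minGens_le {I : Ideal (MvPolynomial (Fin n) K)} {e : Fin n →₀ ℕ}
    (he : monomial e (1 : K) ∈ I) : ∃ v ∈ minGens I, v ≤ e := by
  obtain ⟨v, hv, hmin⟩ :=
    exists_minimal_le_of_wellFoundedLT (fun b => monomial b (1 : K) ∈ I) e he
  exact ⟨v, hmin, hv⟩

theorem degree_le_degI {I : Ideal (MvPolynomial (Fin n) K)} {v : Fin n →₀ ℕ} (hv : v ∈ minGens I) :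
    v.degree ≤ degI I :=
  le_csSup ((minGens_finite I).image _).bddAbove ⟨v, hv, rfl⟩

theorem lt_mI {I : Ideal (MvPolynomial (Fin n) K)} {v : Fin n →₀ ℕ} (hv : v ∈ minGens I)
    {k : Fin n} (hk : v k ≠ 0) : (k : ℕ) + 1 ≤ mI I :=
  (Finset.le_sup (f := fun i : Fin n => (i : ℕ) + 1) (Finsupp.mem_support_iff.2 hk)).trans
    (le_csSup ((minGens_finite I).image _).bddAbove ⟨v, hv, rfl⟩)

/-- In an ideal of Borel type, a power of `x_k` can be traded for a power of `x_i`, `i ≤ k`. -/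
theorem IsBorelType.exists_monomial_mem {I : Ideal (MvPolynomial (Fin n) K)} (hB : IsBorelType I)
    {v : Fin n →₀ ℕ} (hv : monomial v (1 : K) ∈ I) {i k : Fin n} (hik : i ≤ k) :
    ∃ t : ℕ, monomial (v.erase k + Finsupp.single i t) (1 : K) ∈ I := by
  have h1 : monomial (v.erase k) (1 : K) ∈ saturation I (Ideal.span {X k}) := by
    refine Submodule.mem_iSup_of_mem (v k) (Submodule.mem_colon.2 fun s hs => ?_)
    rw [SetLike.mem_coe, Ideal.span_singleton_pow, Ideal.mem_span_singleton'] at hs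
    obtain ⟨c, rfl⟩ := hs
    rw [smul_eq_mul, mul_left_comm, X_pow_eq_monomial, monomial_mul, one_mul,
      Finsupp.erase_add_single]
    exact I.mul_mem_left _ hv
  rw [hB.2 k, saturation, Submodule.mem_iSup_of_directed] at h1
  · obtain ⟨t, ht⟩ := h1
    refine ⟨t, ?_⟩
    have h2 := Submodule.mem_colon.1 ht (X i ^ t)
      (Ideal.pow_mem_pow (Ideal.subset_span (Set.mem_image_of_mem X (Set.mem_Iic.2 hik))) t)
    rwa [smul_eq_mul, X_pow_eq_monomial, monomial_mul, one_mul] at h2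
  · refine Monotone.directed_le fun a b hab => ?_
    intro f hf
    exact Submodule.mem_colon.2 fun s hs => Submodule.mem_colon.1 hf s (Ideal.pow_le_pow_right hab hs)

/-- Only a generator `v` with `v k = e k + 1` is in question. The pigeonhole principle finds an
exponent `e i ≥ degI I` with `i < k`, large enough to absorb whatever power of `X i` replaces the
power of `X k` in `v`. -/
theorem IsBorelType.monomial_mem_of_add_single {I : Ideal (MvPolynomial (Fin n) K)}
    (hB : IsBorelType I) {e : Fin n →₀ ℕ} {k : Fin n} (hsupp : ∀ i, k < i → e i = 0)
    (hdeg : (mI I : ℤ) * ((degI I : ℤ) - 1) + 1 ≤ e.degree)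
    (he : monomial (e + Finsupp.single k 1) (1 : K) ∈ I) : monomial e (1 : K) ∈ I := by
  obtain ⟨v, hv, hve⟩ := exists_minGens_le he
  have hne : ∀ i, i ≠ k → v i ≤ e i := fun i hi => by
    simpa [Finsupp.single_eq_of_ne hi] using hve i
  by_cases hvk : v k ≤ e k
  · refine monomial_mem_of_le (fun i => ?_) hv.1
    by_cases hi : i = k
    · exact hi ▸ hvk
    · exact hne i hi
  have hk : (k : ℕ) + 1 ≤ mI I := lt_mI hv (k := k) (by omega)
  have hvd : v k ≤ degI I := (Finsupp.le_degree k v).trans (degree_le_degI hv)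
  -- Otherwise the `k + 1 ≤ mI I` exponents of `e` that may be nonzero are all at most `degI I - 1`,
  -- against `hdeg`.
  obtain ⟨i, hi⟩ : ∃ i, degI I ≤ e i := by
    by_contra! hlt
    have hd : (0 : ℤ) ≤ (degI I : ℤ) - 1 := by omega
    have h1 : (e.degree : ℤ) ≤ ∑ i ∈ Finset.Iic k, ((degI I : ℤ) - 1) := by
      rw [Finsupp.degree_eq_sum, Nat.cast_sum,
        ← Finset.sum_subset (Finset.subset_univ (Finset.Iic k))]
      · exact Finset.sum_le_sum fun i _ => by have := hlt i; omega
      · intro i _ hi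
        rw [hsupp i (by simpa using hi), Nat.cast_zero]
    rw [Finset.sum_const, Fin.card_Iic, nsmul_eq_mul] at h1
    have h2 : ((k + 1 : ℕ) : ℤ) * ((degI I : ℤ) - 1) ≤ (mI I : ℤ) * ((degI I : ℤ) - 1) :=
      mul_le_mul_of_nonneg_right (by exact_mod_cast hk) hd
    omega
  have hik : i < k := by
    rcases lt_trichotomy i k with h | h | h
    · exact h
    · subst h; omega
    · have := hsupp i h; omega
  obtain ⟨t, ht⟩ := hB.exists_monomial_mem hv.1 hik.le
  -- The exponent `t` is uncontrolled, but a minimal generator `u` below has `u i ≤ degI I ≤ e i`.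
  obtain ⟨u, hu, hule⟩ := exists_minGens_le ht
  refine monomial_mem_of_le (fun j => ?_) hu.1
  have hj := hule j
  by_cases hji : j = i
  · subst hji
    exact ((Finsupp.le_degree j u).trans (degree_le_degI hu)).trans hi
  · simp only [Finsupp.coe_add, Pi.add_apply, Finsupp.single_eq_of_ne hji, add_zero] at hj
    by_cases hjk : j = k
    · subst hjk
      simp at hj
      omega
    · rw [Finsupp.erase_ne hjk] at hj
      exact hj.trans (hne j hjk)

/-! ### Working modulo the last variables -/

/-- The ideal generated by the variables `X l` with `k ≤ l`. -/
noncomputable def varsGe (K : Type*) [Field K] (n k : ℕ) : Ideal (MvPolynomial (Fin n) K) :=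
  Ideal.span (X '' {l : Fin n | k ≤ l})

theorem mem_varsGe {k : ℕ} {f : MvPolynomial (Fin n) K} :
    f ∈ varsGe K n k ↔ ∀ e ∈ f.support, ∃ l : Fin n, k ≤ l ∧ e l ≠ 0 :=
  mem_ideal_span_X_image

theorem varsGe_eq_bot : varsGe K n n = ⊥ := by
  rw [varsGe, Ideal.span_eq_bot]
  rintro _ ⟨l, hl, rfl⟩
  exact absurd l.2 (not_lt.2 hl)

theorem varsGe_zero : varsGe K n 0 = Ideal.span (Set.range X) := by
  rw [varsGe, ← Set.image_univ]
  congr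
  ext
  simp

theorem varsGe_succ_le (k : ℕ) : varsGe K n (k + 1) ≤ varsGe K n k :=
  Ideal.span_mono (Set.image_mono fun l (hl : k + 1 ≤ (l : ℕ)) => (Nat.le_succ k).trans hl)

theorem X_mem_varsGe (k : Fin n) : (X k : MvPolynomial (Fin n) K) ∈ varsGe K n k :=
  Ideal.subset_span (Set.mem_image_of_mem X (le_refl (k : ℕ)))

/-- Multiplying a monomial by `X k` introduces none of the later variables. -/
theorem mem_varsGe_of_X_mul_mem {k : Fin n} {f : MvPolynomial (Fin n) K}
    (h : X k * f ∈ varsGe K n (k + 1)) : f ∈ varsGe K n (k + 1) := by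
  rw [mem_varsGe] at h ⊢
  intro e he
  obtain ⟨l, hl, hne⟩ := h (Finsupp.single k 1 + e) (by
    rw [mem_support_iff, coeff_X_mul]
    exact mem_support_iff.1 he)
  refine ⟨l, hl, ?_⟩
  have hlk : l ≠ k := fun h => by subst h; omega
  simpa [Finsupp.single_eq_of_ne hlk] using hne

/-- Take for `u` the quotient of `f` by `X k`. The terms of the remainder involve a variable of
index at least `k`, but not `X k`. -/
theorem exists_sub_X_mul_mem_varsGe {k : Fin n} {t : ℤ} {f : MvPolynomial (Fin n) K}
    (hf : IsHomog t f) (h : f ∈ varsGe K n k) :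
    ∃ u, IsHomog (t - 1) u ∧ f - X k * u ∈ varsGe K n (k + 1) := by
  refine ⟨f.divMonomial (Finsupp.single k 1), fun e he => ?_, ?_⟩
  · rw [mem_support_iff, coeff_divMonomial] at he
    have := hf _ (mem_support_iff.2 he)
    rw [map_add, Finsupp.degree_single] at this
    push_cast at this
    omega
  · have h1 := divMonomial_add_modMonomial_single f k
    rw [← eq_sub_iff_add_eq'] at h1
    rw [← h1, mem_varsGe]
    intro e he
    have hek : e k = 0 := by
      by_contra hne
      refine mem_support_iff.1 he (coeff_modMonomial_of_le f ?_)
      rw [Finsupp.single_le_iff]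
      omega
    have hcoeff := coeff_modMonomial_of_not_le (s := Finsupp.single k 1) (s' := e) f (by
      rw [Finsupp.single_le_iff]
      omega)
    rw [mem_support_iff, hcoeff] at he
    obtain ⟨l, hl, hne⟩ := mem_varsGe.1 h e (mem_support_iff.2 he)
    refine ⟨l, lt_of_le_of_ne hl fun hkl => hne ?_, hne⟩
    rw [← Fin.ext hkl, hek]

theorem comp_mem_varsGe {k : ℕ} {f : MvPolynomial (Fin n) K} (t : ℤ) (hf : f ∈ varsGe K n k) :
    comp t f ∈ varsGe K n k := by
  rw [mem_varsGe] at hf ⊢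
  intro e he
  refine hf e (mem_support_iff.2 fun h => mem_support_iff.1 he ?_)
  simp [coeff_comp, h]

theorem map_mem_of_forall_mem {r s : ℕ} (J : Ideal (MvPolynomial (Fin n) K))
    (φ : (Fin r → MvPolynomial (Fin n) K) →ₗ[MvPolynomial (Fin n) K]
      (Fin s → MvPolynomial (Fin n) K)) {v : Fin r → MvPolynomial (Fin n) K}
    (hv : ∀ a, v a ∈ J) (b : Fin s) : φ v b ∈ J := by
  rw [linearMap_apply_eq_sum φ v, Finset.sum_apply]
  exact J.sum_mem fun a _ => J.mul_mem_right _ (hv a)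

/-! ### Exactness of a graded resolution modulo the last variables -/

/-- An exact sequence `⋯ → P_2 → P_1 → P_0` of graded free modules of finite rank. -/
structure GradedRes (K : Type*) [Field K] (n : ℕ) where
  rank : ℕ → ℕ
  w : ∀ i, Fin (rank i) → ℤ
  d : ∀ i, (Fin (rank (i + 1)) → MvPolynomial (Fin n) K) →ₗ[MvPolynomial (Fin n) K]
    (Fin (rank i) → MvPolynomial (Fin n) K)
  d_homogeneous : ∀ i a, IsHomogeneousVec (w i) (d i (Pi.single a 1)) (w (i + 1) a)
  exact_d : ∀ i, Function.Exact (d (i + 1)) (d i)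

namespace GradedRes

variable (P : GradedRes K n)

/-- A homogeneous vector that is a boundary modulo `(X l : k ≤ l)` is the boundary of a homogeneous
vector modulo this ideal. -/
theorem exists_homogeneous_boundary {i k : ℕ} {t : ℤ} {v : Fin (P.rank i) → MvPolynomial (Fin n) K}
    (hv : IsHomogeneousVec (P.w i) v t) {y : Fin (P.rank (i + 1)) → MvPolynomial (Fin n) K}
    (hy : ∀ b, v b - P.d i y b ∈ varsGe K n k) :
    ∃ y', IsHomogeneousVec (P.w (i + 1)) y' t ∧ ∀ b, v b - P.d i y' b ∈ varsGe K n k := by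
  refine ⟨compVec (P.w (i + 1)) t y, isHomogeneousVec_compVec _ _ _, fun b => ?_⟩
  have h := comp_mem_varsGe (t - P.w i b) (hy b)
  rw [map_compVec (P.d i) (P.d_homogeneous i)]
  have h2 : comp (t - P.w i b) (v b) = v b := (isHomogeneousVec_iff.1 hv b).comp_eq
  rwa [comp_sub, h2] at h

/-- If multiplication by `x_k` is injective in degrees `≥ ρ` on the cokernel of `P_1 → P_0` modulo
`x_{k+1}, …, x_n` for all `k`, then `P/(x_k, …, x_n)P` is exact at the `i`-th place in degrees
`> ρ + i - 1`, for all `i ≥ 1`. -/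
theorem exists_boundary_of_cycle (ρ : ℤ)
    (h0 : ∀ (k : Fin n) (t : ℤ) (u : Fin (P.rank 0) → MvPolynomial (Fin n) K),
      ρ ≤ t → IsHomogeneousVec (P.w 0) u t →
      (∃ y, ∀ b, X k * u b - P.d 0 y b ∈ varsGe K n (k + 1)) →
        ∃ y, ∀ b, u b - P.d 0 y b ∈ varsGe K n (k + 1))
    {k : ℕ} (hk : k ≤ n) (i : ℕ) (t : ℤ) (ht : ρ + i < t)
    (v : Fin (P.rank (i + 1)) → MvPolynomial (Fin n) K)
    (hv : IsHomogeneousVec (P.w (i + 1)) v t) (hdv : ∀ b, P.d i v b ∈ varsGe K n k) :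
    ∃ y, ∀ b, v b - P.d (i + 1) y b ∈ varsGe K n k := by
  induction hk using Nat.decreasingInduction generalizing i t v with
  | self =>
    have hz : P.d i v = 0 := funext fun b => by simpa [varsGe_eq_bot] using hdv b
    obtain ⟨y, hy⟩ := (P.exact_d i v).1 hz
    exact ⟨y, fun b => by simp [hy]⟩
  | of_succ k hkn ih =>
    obtain ⟨κ, rfl⟩ : ∃ κ : Fin n, (κ : ℕ) = k := ⟨⟨k, hkn⟩, rfl⟩
    have hdvh := isHomogeneousVec_iff.1 (hv.map (P.d_homogeneous i))
    -- Modulo the later variables, `d v = X κ * u`, where `u` has degree `t - 1`. The aim is to show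
    -- that `u` is a boundary there.
    choose u hu hsub using fun b => exists_sub_X_mul_mem_varsGe (hdvh b) (hdv b)
    have huh : IsHomogeneousVec (P.w i) u (t - 1) := isHomogeneousVec_iff.2 fun b => by
      rw [sub_right_comm]
      exact hu b
    have hy : ∃ y, ∀ b, u b - P.d i y b ∈ varsGe K n (κ + 1) := by
      obtain _ | i := i
      · refine h0 κ (t - 1) u (by push_cast at ht; omega) huh ⟨v, fun b => ?_⟩
        rw [← neg_sub]
        exact neg_mem (hsub b)
      · refine ih i (t - 1) (by push_cast at ht; omega) u huh fun b => ?_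
        refine mem_varsGe_of_X_mul_mem ?_
        -- Applying `d` to `d v - X κ • u` leaves `-X κ • d u`, and `X κ` can be cancelled, so `u`
        -- is a cycle modulo the later variables.
        have h1 := map_mem_of_forall_mem (varsGe K n (κ + 1)) (P.d i)
          (v := P.d (i + 1) v - (X κ : MvPolynomial (Fin n) K) • u) hsub b
        rw [map_sub, map_smul, (P.exact_d i).apply_apply_eq_zero, zero_sub] at h1
        simpa using h1
    obtain ⟨y₀, hy₀⟩ := hy
    obtain ⟨y, hyh, hy⟩ := P.exists_homogeneous_boundary huh hy₀
    -- Subtracting `X κ • y` turns `v` into a cycle modulo the later variables, and changes nothing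
    -- modulo `X κ`.
    have hvy : IsHomogeneousVec (P.w (i + 1)) (v - (X κ : MvPolynomial (Fin n) K) • y) t :=
      isHomogeneousVec_iff.2 fun b => (isHomogeneousVec_iff.1 hv b).sub (by
        have h1 := (isHomog_X κ).mul (isHomogeneousVec_iff.1 hyh b)
        rwa [show 1 + (t - 1 - P.w (i + 1) b) = t - P.w (i + 1) b by ring] at h1)
    obtain ⟨z, hz⟩ := ih i t ht _ hvy fun b => by
      have h1 := add_mem (hsub b) (Ideal.mul_mem_left _ (X κ) (hy b))
      rw [map_sub, map_smul]
      convert h1 using 1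
      simp only [Pi.sub_apply, Pi.smul_apply, smul_eq_mul]
      ring
    refine ⟨z, fun b => ?_⟩
    have h1 := add_mem (varsGe_succ_le _ (hz b)) (Ideal.mul_mem_right (y b) _ (X_mem_varsGe κ))
    convert h1 using 1
    simp only [Pi.sub_apply, Pi.smul_apply, smul_eq_mul]
    ring

end GradedRes

/-! ### Application to S/I and the bound on the degrees -/

/-- For an ideal of Borel type, `x_k` acts injectively on `S/(I, x_{k+1}, …, x_n)` in degrees
`≥ m(I)(deg(I) - 1) + 1`. -/
theorem IsBorelType.mem_sup_varsGe_of_X_mul_mem {I : Ideal (MvPolynomial (Fin n) K)}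
    (hB : IsBorelType I) {k : Fin n} {t : ℤ} (ht : (mI I : ℤ) * ((degI I : ℤ) - 1) + 1 ≤ t)
    {f : MvPolynomial (Fin n) K} (hf : IsHomog t f) (h : X k * f ∈ I ⊔ varsGe K n (k + 1)) :
    f ∈ I ⊔ varsGe K n (k + 1) := by
  classical
  obtain ⟨a, ha, b, hb, hab⟩ := Submodule.mem_sup.1 h
  rw [f.as_sum]
  refine Ideal.sum_mem _ fun e he => ?_
  by_cases hl : ∃ l : Fin n, (k : ℕ) + 1 ≤ l ∧ e l ≠ 0
  · refine Ideal.mem_sup_right (mem_varsGe.2 fun e' he' => ?_)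
    rw [Finset.mem_singleton.1 (support_monomial_subset he')]
    exact hl
  push Not at hl
  -- The monomial `e` involves no variable after `X k`, so neither does its product with `X k`,
  -- which therefore cannot occur in `b`.
  have hXf : coeff (e + Finsupp.single k 1) a ≠ 0 := by
    intro h0
    have h1 : coeff (e + Finsupp.single k 1) b ≠ 0 := by
      have h2 : coeff (Finsupp.single k 1 + e) (a + b) = coeff e f := by rw [hab, coeff_X_mul]
      rw [add_comm, coeff_add, h0, zero_add] at h2
      rw [h2]
      exact mem_support_iff.1 he
    obtain ⟨l, hkl, hne⟩ := mem_varsGe.1 hb _ (mem_support_iff.2 h1)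
    have hlk : l ≠ k := fun h => by subst h; omega
    simp [Finsupp.single_eq_of_ne hlk, hl l hkl] at hne
  have hmem : monomial e (1 : K) ∈ I :=
    hB.monomial_mem_of_add_single (fun i hi => hl i hi) (by rw [hf e he]; exact ht)
      (hB.1.mem_iff.1 ha _ (mem_support_iff.2 hXf))
  refine Ideal.mem_sup_left ?_
  rw [← mul_one (coeff e f), ← C_mul_monomial]
  exact I.mul_mem_left _ hmem

theorem mI_eq_zero_of_degI_eq_zero {I : Ideal (MvPolynomial (Fin n) K)} (h : degI I = 0) :
    mI I = 0 := by
  refine Nat.le_zero.1 (csSup_le' ?_)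
  rintro _ ⟨v, hv, rfl⟩
  have h0 : v = 0 := (Finsupp.degree_eq_zero_iff v).1 (Nat.le_zero.1 (h ▸ degree_le_degI hv))
  simp [h0, mMon]

/-- The second factor is negative only when `degI I = 0`, and then the first factor vanishes. -/
theorem zero_le_mI_mul_degI_sub_one (I : Ideal (MvPolynomial (Fin n) K)) :
    (0 : ℤ) ≤ (mI I : ℤ) * ((degI I : ℤ) - 1) := by
  rcases Nat.eq_zero_or_pos (degI I) with h | h
  · simp [mI_eq_zero_of_degI_eq_zero h]
  · exact mul_nonneg (Nat.cast_nonneg _) (by omega)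

namespace MinGradedFreeRes

variable {I : Ideal (MvPolynomial (Fin n) K)} (F : MinGradedFreeRes I)

/-- The ranks of the resolution `⋯ → F_1 → F_0 → S` of `S/I`. -/
def extRank : ℕ → ℕ
  | 0 => 1
  | i + 1 => F.rank i

/-- The degrees of the basis vectors in the resolution `⋯ → F_1 → F_0 → S` of `S/I`. -/
def extWeight : ∀ i, Fin (F.extRank i) → ℤ
  | 0 => fun _ => 0
  | i + 1 => F.w i

/-- The differentials of the resolution `⋯ → F_1 → F_0 → S` of `S/I`. -/
noncomputable def extD : ∀ i, (Fin (F.extRank (i + 1)) → MvPolynomial (Fin n) K)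
    →ₗ[MvPolynomial (Fin n) K] (Fin (F.extRank i) → MvPolynomial (Fin n) K)
  | 0 => vecOne.toLinearMap ∘ₗ I.subtype ∘ₗ F.aug
  | i + 1 => F.d i

/-- The resolution `⋯ → F_1 → F_0 → S` of `S/I`. -/
noncomputable def extRes : GradedRes K n where
  rank := F.extRank
  w := F.extWeight
  d := F.extD
  d_homogeneous
    | 0 => fun a b e he => (add_zero _).trans (F.aug_homogeneous a e he)
    | i + 1 => F.d_homogeneous i
  exact_d
    | 0 => fun v => by
      refine Iff.trans ?_ (F.exact_zero v)
      exact (LinearEquiv.map_eq_zero_iff (vecOne (K := K) (n := n))).trans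
        (Submodule.coe_eq_zero)
    | i + 1 => F.exact_succ i

/-- A basis vector of larger degree would be a cycle modulo all variables, hence a boundary modulo
them. By minimality boundaries vanish there, while the basis vector does not. -/
theorem w_le (hB : IsBorelType I) (i : ℕ) (a : Fin (F.rank i)) :
    F.w i a ≤ (mI I : ℤ) * ((degI I : ℤ) - 1) + 1 + i := by
  by_contra! hlt
  have hρ := zero_le_mI_mul_degI_sub_one I
  have hsingle : IsHomogeneousVec (F.w i) (Pi.single a (1 : MvPolynomial (Fin n) K)) (F.w i a) :=
    isHomogeneousVec_single _ a
  obtain ⟨y, hy⟩ := F.extRes.exists_boundary_of_cycle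
    ((mI I : ℤ) * ((degI I : ℤ) - 1) + 1) (fun k t u ht hu hX => by
      obtain ⟨y, hy⟩ := hX
      have hu0 : IsHomog t (u (0 : Fin 1)) := by
        have h1 := isHomogeneousVec_iff.1 hu (0 : Fin 1)
        rwa [show t - F.extRes.w 0 (0 : Fin 1) = t from sub_zero t] at h1
      have h1 : X k * u (0 : Fin 1) ∈ I ⊔ varsGe K n (k + 1) := by
        rw [← add_sub_cancel (F.aug y : MvPolynomial (Fin n) K) (X k * u (0 : Fin 1))]
        exact add_mem (Ideal.mem_sup_left (F.aug y).2) (Ideal.mem_sup_right (hy (0 : Fin 1)))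
      obtain ⟨g, hg, h, hh, hgh⟩ := Submodule.mem_sup.1
        (hB.mem_sup_varsGe_of_X_mul_mem ht hu0 h1)
      obtain ⟨z, hz⟩ := F.aug_surjective ⟨g, hg⟩
      refine ⟨z, fun b => ?_⟩
      obtain rfl : b = (0 : Fin 1) := Subsingleton.elim (α := Fin 1) b 0
      have h2 : F.extRes.d 0 z (0 : Fin 1) = g := congrArg Subtype.val hz
      rw [h2, ← hgh, add_sub_cancel_left]
      exact hh)
    (Nat.zero_le n) i (F.w i a) hlt (Pi.single a (1 : MvPolynomial (Fin n) K)) hsingle (by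
      obtain _ | i := i
      · intro b
        -- Minimality says nothing about `aug`. Instead, a nonzero constant term would force degree
        -- 0, whereas `hlt` and `hρ` make the degree positive.
        rw [varsGe_zero, mem_span_range_X_iff]
        by_contra hne
        have h1 := F.aug_homogeneous a 0 (mem_support_iff.2 hne)
        simp at h1
        push_cast at hlt
        omega
      · intro b
        rw [varsGe_zero]
        exact F.minimal i _ b)
  have h1 := add_mem (hy a) (varsGe_zero (K := K) (n := n) ▸ F.minimal i y a)
  have h2 : (Pi.single a (1 : MvPolynomial (Fin n) K) : Fin (F.rank i) → _) a ∈
      varsGe K n 0 := by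
    convert h1 using 1
    exact (sub_add_cancel _ _).symm
  rw [varsGe_zero, mem_span_range_X_iff, Pi.single_eq_same] at h2
  simp at h2

theorem rank_zero_ne_zero (hI : I ≠ ⊥) : F.rank 0 ≠ 0 := by
  intro h
  have : IsEmpty (Fin (F.rank 0)) := by rw [h]; infer_instance
  refine hI ((Submodule.eq_bot_iff I).2 fun f hf => ?_)
  obtain ⟨v, hv⟩ := F.aug_surjective ⟨f, hf⟩
  rw [Subsingleton.elim v 0, map_zero] at hv
  exact (congrArg Subtype.val hv).symm

theorem betti_ne_zero_iff {i : ℕ} {j : ℤ} : F.betti i j ≠ 0 ↔ ∃ a, F.w i a = j := by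
  rw [betti, ← Nat.pos_iff_ne_zero, Fintype.card_pos_iff, nonempty_subtype]

end MinGradedFreeRes

end BorelReg

theorem corollary2p4 {K : Type*} [Field K] {n : ℕ} (I : Ideal (MvPolynomial (Fin n) K))
    (hI : I ≠ ⊥) (hB : BorelReg.IsBorelType I) :
    Nonempty (BorelReg.MinGradedFreeRes I) ∧
      ∀ F : BorelReg.MinGradedFreeRes I, ∃ r : ℤ, F.IsReg r ∧
        r ≤ (BorelReg.mI I : ℤ) * ((BorelReg.degI I : ℤ) - 1) + 1 := by
  refine ⟨hB.1.nonempty_minGradedFreeRes, fun F => ?_⟩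
  have hbound : ∀ t ∈ {t : ℤ | ∃ (i : ℕ) (j : ℤ), F.betti i j ≠ 0 ∧ t = j - i},
      t ≤ (BorelReg.mI I : ℤ) * ((BorelReg.degI I : ℤ) - 1) + 1 := by
    rintro _ ⟨i, j, hij, rfl⟩
    obtain ⟨a, rfl⟩ := F.betti_ne_zero_iff.1 hij
    have := F.w_le hB i a
    omega
  -- The maximum exists because the set is bounded above and `F_0 ≠ 0` makes it nonempty.
  obtain ⟨r, hr, hmax⟩ := Int.exists_greatest_of_bdd ⟨_, hbound⟩
    ⟨_, 0, F.w 0 ⟨0, Nat.pos_of_ne_zero (F.rank_zero_ne_zero hI)⟩,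
      F.betti_ne_zero_iff.2 ⟨_, rfl⟩, rfl⟩
  exact ⟨r, ⟨hr, fun t ht => hmax t ht⟩, hbound r hr⟩
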